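/- Let $d\ge 1$ and let $Q\subset\mathbb{R}^d$ be a convex body (a compact convex set with non-empty interior) that contains the origin. Then there exist a one-dimensional linear subspace $L\subseteq\mathbb{R}^d$ and a linear (not necessarily orthogonal) projection $P:\mathbb{R}^d\to\mathbb{R}^d$ onto $L$ (that is, $P$ is linear, $P(\mathbb{R}^d)\subseteq L$, and $Px=x$ for all $x\in L$) such that $P(Q)\subseteq Q$. -/

import Mathlib

/-! Take `P x = f x • y` with `f y = 1`; it suffices that `f` maps `Q` into some `[a, 1]` with `y`,
`a • y ∈ Q`. If `0` is a boundary point, rescale a functional supporting `Q` there and take `a = 0`.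
If `0` is interior, let `l` be least with `-Q ⊆ l • Q`; contact of `-Q` with the boundary of `l • Q`
gives `y`, with `a = -l`. -/

section RankOneProjection

variable {E : Type*} [NormedAddCommGroup E] [NormedSpace ℝ E]

/-- A functional `f` with `f y = 1` whose values on the convex set `Q` lie in `[a, 1]`, where `y`
and `a • y` lie in `Q`, gives a projection onto the line of `y` mapping `Q` into itself. -/
theorem exists_isProj_of_functional {Q : Set E} (hQ : Convex ℝ Q) (f : E →ₗ[ℝ] ℝ) {y : E} {a : ℝ}
    (hfy : f y = 1) (hy : y ∈ Q) (hay : a • y ∈ Q) (hf : ∀ q ∈ Q, a ≤ f q ∧ f q ≤ 1) :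
    ∃ (L : Submodule ℝ E) (P : E →ₗ[ℝ] E),
      Module.finrank ℝ L = 1 ∧ LinearMap.IsProj L P ∧ P '' Q ⊆ Q := by
  have hy0 : y ≠ 0 := by
    rintro rfl
    simp at hfy
  refine ⟨ℝ ∙ y, f.smulRight y, finrank_span_singleton hy0, ⟨fun x => ?_, fun x hx => ?_⟩, ?_⟩
  · exact Submodule.mem_span_singleton.2 ⟨f x, rfl⟩
  · obtain ⟨c, rfl⟩ := Submodule.mem_span_singleton.1 hx
    simp [hfy]
  · rintro _ ⟨q, hq, rfl⟩
    have hconv : Convex ℝ {t : ℝ | t • y ∈ Q} :=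
      hQ.is_linear_preimage (IsLinearMap.mk (fun s t => add_smul s t y) fun c t => mul_smul c t y)
    exact hconv.ordConnected.out (x := a) hay (y := 1) (by simpa using hy) (hf q hq)

/-- At a point outside the interior of a closed convex set with non-empty interior there is a
functional maximal over the set at that point, strictly so over the interior. -/
theorem exists_support_functional {Q : Set E} (hQ : Convex ℝ Q) (hcl : IsClosed Q)
    (hint : (interior Q).Nonempty) {y : E} (hy : y ∉ interior Q) :
    ∃ f : StrongDual ℝ E, (∀ q ∈ interior Q, f q < f y) ∧ ∀ q ∈ Q, f q ≤ f y := by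
  obtain ⟨f, hf⟩ := geometric_hahn_banach_open_point hQ.interior isOpen_interior hy
  refine ⟨f, hf, fun q hq => ?_⟩
  have hq' : q ∈ closure (interior Q) := by
    rwa [hQ.closure_interior_eq_closure_of_nonempty_interior hint, hcl.closure_eq]
  exact closure_minimal (fun a ha => (hf a ha).le) (isClosed_le f.continuous continuous_const) hq'

theorem exists_isProj_of_zero_notMem_interior {Q : Set E} (hQ : Convex ℝ Q) (hc : IsCompact Q)
    (hint : (interior Q).Nonempty) (h0 : (0 : E) ∈ Q) (h0' : (0 : E) ∉ interior Q) :
    ∃ (L : Submodule ℝ E) (P : E →ₗ[ℝ] E),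
      Module.finrank ℝ L = 1 ∧ LinearMap.IsProj L P ∧ P '' Q ⊆ Q := by
  obtain ⟨f, hf, hf'⟩ := exists_support_functional hQ hc.isClosed hint h0'
  simp only [map_zero] at hf hf'
  obtain ⟨y, hy, hmin⟩ := hc.exists_isMinOn ⟨0, h0⟩ f.continuous.continuousOn
  obtain ⟨p, hp⟩ := hint
  have hfy : f y < 0 := (hmin (interior_subset hp)).trans_lt (hf p hp)
  refine exists_isProj_of_functional hQ ((f y)⁻¹ • (f : E →ₗ[ℝ] ℝ)) (y := y) (a := 0)
    (by simp [hfy.ne]) hy (by simpa using h0) fun q hq => ?_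
  have h1 : f y ≤ f q := hmin hq
  have h2 := hf' q hq
  simp only [LinearMap.smul_apply, ContinuousLinearMap.coe_coe, smul_eq_mul]
  rw [← div_eq_inv_mul]
  exact ⟨div_nonneg_of_nonpos h2 hfy.le, (div_le_one_of_neg hfy).2 h1⟩

theorem exists_isProj_of_zero_mem_interior [Nontrivial E] {Q : Set E} (hQ : Convex ℝ Q)
    (hc : IsCompact Q) (h0 : (0 : E) ∈ interior Q) :
    ∃ (L : Submodule ℝ E) (P : E →ₗ[ℝ] E),
      Module.finrank ℝ L = 1 ∧ LinearMap.IsProj L P ∧ P '' Q ⊆ Q := by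
  have hnhds : Q ∈ nhds (0 : E) := mem_interior_iff_mem_nhds.1 h0
  have habs : Absorbent ℝ Q := absorbent_nhds_zero hnhds
  have hmem : ∀ x, gauge Q x ≤ 1 → x ∈ Q := fun x hx => by
    rw [gauge_le_one_iff_mem_closure hQ hnhds, hc.isClosed.closure_eq] at hx
    exact hx
  obtain ⟨x, hx, hmax⟩ := hc.exists_isMaxOn ⟨0, interior_subset h0⟩
    ((continuous_gauge hQ hnhds).comp continuous_neg).continuousOn
  set l := gauge Q (-x) with hl
  have hle : ∀ q ∈ Q, gauge Q (-q) ≤ l := fun q hq => hmax hq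
  have hlpos : 0 < l := by
    obtain ⟨z, hz, hz0⟩ := Filter.nonempty_of_mem
      (Filter.inter_mem (nhdsWithin_le_nhds hnhds) (self_mem_nhdsWithin (s := {(0 : E)}ᶜ)))
    refine lt_of_lt_of_le ?_ (hle z hz)
    exact (gauge_pos habs (NormedSpace.isVonNBounded_iff ℝ |>.2 hc.isBounded)).2 (neg_ne_zero.2 hz0)
  have hscale : ∀ q, gauge Q (l⁻¹ • q) = l⁻¹ * gauge Q q := fun q => by
    rw [gauge_smul_of_nonneg (inv_pos.2 hlpos).le, smul_eq_mul]
  -- The contact point, scaled back to the boundary of `Q`; thus `-l • y = x ∈ Q`.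
  set y := l⁻¹ • (-x) with hy
  have hgy : gauge Q y = 1 := by rw [hscale, ← hl, inv_mul_cancel₀ hlpos.ne']
  have hyint : y ∉ interior Q := fun h => by
    rw [← gauge_lt_one_iff_mem_interior hQ hnhds, hgy] at h
    exact lt_irrefl _ h
  obtain ⟨f, hf, hf'⟩ := exists_support_functional hQ hc.isClosed ⟨0, h0⟩ hyint
  have hfy : 0 < f y := by simpa using hf 0 h0
  refine exists_isProj_of_functional hQ ((f y)⁻¹ • (f : E →ₗ[ℝ] ℝ)) (y := y) (a := -l)
    (by simp [hfy.ne']) (hmem y hgy.le) (by simpa [hy, smul_smul, hlpos.ne'] using hx)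
    fun q hq => ?_
  -- As `-Q ⊆ l • Q`, the upper bound on `f` also yields the lower bound `-l * f y`.
  have h1 : f (l⁻¹ • (-q)) ≤ f y := hf' _ <| hmem _ <| by
    rw [hscale, inv_mul_le_one₀ hlpos]
    exact hle q hq
  rw [map_smul, map_neg, smul_eq_mul, inv_mul_le_iff₀ hlpos] at h1
  simp only [LinearMap.smul_apply, ContinuousLinearMap.coe_coe, smul_eq_mul]
  rw [← div_eq_inv_mul, le_div_iff₀ hfy, div_le_one hfy]
  exact ⟨by linarith, hf' q hq⟩

end RankOneProjection

theorem proposition2p1 (d : ℕ) (hd : 1 ≤ d)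
    (Q : ConvexBody (EuclideanSpace ℝ (Fin d)))
    (hQ_int : (interior (Q : Set (EuclideanSpace ℝ (Fin d)))).Nonempty)
    (hQ_zero : (0 : EuclideanSpace ℝ (Fin d)) ∈ (Q : Set (EuclideanSpace ℝ (Fin d)))) :
    ∃ (L : Submodule ℝ (EuclideanSpace ℝ (Fin d)))
      (P : EuclideanSpace ℝ (Fin d) →ₗ[ℝ] EuclideanSpace ℝ (Fin d)),
      Module.finrank ℝ L = 1 ∧ LinearMap.IsProj L P ∧
        P '' (Q : Set (EuclideanSpace ℝ (Fin d))) ⊆ (Q : Set (EuclideanSpace ℝ (Fin d))) := by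
  have : Nonempty (Fin d) := ⟨⟨0, hd⟩⟩
  by_cases h0 : (0 : EuclideanSpace ℝ (Fin d)) ∈ interior (Q : Set (EuclideanSpace ℝ (Fin d)))
  · exact exists_isProj_of_zero_mem_interior Q.convex Q.isCompact h0
  · exact exists_isProj_of_zero_notMem_interior Q.convex Q.isCompact hQ_int hQ_zero h0
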